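/- Let $n,p\ge 1$, let $\Omega\subset\mathbb{R}^n\times\mathbb{R}^p$ be open, let $f:\Omega\to\mathbb{R}^n$ be of class $C^1$, and let $t_0<t_1$. A $C^1$ trajectory of the control system $x'=f(x,u)$ on $[t_0,t_1]$ is a pair $(x,u)$ of $C^1$ functions $x:[t_0,t_1]\to\mathbb{R}^n$, $u:[t_0,t_1]\to\mathbb{R}^p$ such that $(x(t),u(t))\in\Omega$ and $x'(t)=f(x(t),u(t))$ for all $t\in[t_0,t_1]$. Let $(\bar x,\bar u)$ be a $C^1$ trajectory on $[t_0,t_1]$ and put $A(t)=\partial_x f(\bar x(t),\bar u(t))$, $B(t)=\partial_u f(\bar x(t),\bar u(t))$. Assume that the linearized system $x'(t)=A(t)x(t)+B(t)u(t)$ is controllable for the time interval $[t_0,t_1]$, i.e., for all $x_0,x_1\in\mathbb{R}^n$ there is $u\in L^2((t_0,t_1),\mathbb{R}^p)$ such that the solution $x\in C([t_0,t_1],\mathbb{R}^n)$ of $$x(t)=x_0+\int_{t_0}^t A(s)x(s)\,ds+\int_{t_0}^t B(s)u(s)\,ds,\qquad t\in[t_0,t_1],$$ satisfies $x(t_1)=x_1$.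 Then $x'=f(x,u)$ is locally controllable along $(\bar x,\bar u)$: for every $\varepsilon>0$ there is $\delta>0$ such that for all $x_0\in B(\bar x(t_0),\delta)$ and $x_1\in B(\bar x(t_1),\delta)$ there is a $C^1$ trajectory $(x,u)$ of $x'=f(x,u)$ on $[t_0,t_1]$ with $$\|u-\bar u\|_{C^1([t_0,t_1])}\le\varepsilon,\qquad x(t_0)=x_0,\qquad x(t_1)=x_1,$$ where $\|g\|_{C^1([t_0,t_1])}=\sup_{[t_0,t_1]}\|g\|+\sup_{[t_0,t_1]}\|g'\|$. -/

import Mathlib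

open Set MeasureTheory

noncomputable section

/-- `(x, u)` is a `C¹` trajectory on `[t₀, t₁]` of the control system `x' = f(x, u)`, where `f` is
considered on the set `Ω` of state-control pairs: `x` and `u` are of class `C¹` on the closed
interval (one-sided derivatives at the end points), `(x(t), u(t))` stays in `Ω`, and
`x'(t) = f(x(t), u(t))` for all `t ∈ [t₀, t₁]`. Values outside `[t₀, t₁]` play no role. -/
structure IsC1Trajectory {n p : ℕ}
    (Ω : Set (EuclideanSpace ℝ (Fin n) × EuclideanSpace ℝ (Fin p)))
    (f : EuclideanSpace ℝ (Fin n) × EuclideanSpace ℝ (Fin p) → EuclideanSpace ℝ (Fin n))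
    (t₀ t₁ : ℝ) (x : ℝ → EuclideanSpace ℝ (Fin n)) (u : ℝ → EuclideanSpace ℝ (Fin p)) :
    Prop where
  contDiffOn_state : ContDiffOn ℝ 1 x (Icc t₀ t₁)
  contDiffOn_control : ContDiffOn ℝ 1 u (Icc t₀ t₁)
  mem_domain : ∀ t ∈ Icc t₀ t₁, (x t, u t) ∈ Ω
  hasDerivWithinAt : ∀ t ∈ Icc t₀ t₁, HasDerivWithinAt x (f (x t, u t)) (Icc t₀ t₁) t

/-- The norm of `C¹([t₀, t₁])`: `sup ‖g‖ + sup ‖g'‖` over `[t₀, t₁]`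
(meant for functions of class `C¹` on `[t₀, t₁]`, for which both suprema are finite). -/
def c1Norm {p : ℕ} (t₀ t₁ : ℝ) (g : ℝ → EuclideanSpace ℝ (Fin p)) : ℝ :=
  (⨆ t : Icc t₀ t₁, ‖g t‖) + ⨆ t : Icc t₀ t₁, ‖derivWithin g (Icc t₀ t₁) t‖

/-- Local controllability of `x' = f(x, u)` along `(xbar, ubar)` on `[t₀, t₁]`. -/
def LocallyControllableAlong {n p : ℕ}
    (Ω : Set (EuclideanSpace ℝ (Fin n) × EuclideanSpace ℝ (Fin p)))
    (f : EuclideanSpace ℝ (Fin n) × EuclideanSpace ℝ (Fin p) → EuclideanSpace ℝ (Fin n))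
    (t₀ t₁ : ℝ) (xbar : ℝ → EuclideanSpace ℝ (Fin n)) (ubar : ℝ → EuclideanSpace ℝ (Fin p)) :
    Prop :=
  ∀ ε : ℝ, 0 < ε → ∃ δ : ℝ, 0 < δ ∧
    ∀ x₀ ∈ Metric.ball (xbar t₀) δ, ∀ x₁ ∈ Metric.ball (xbar t₁) δ,
      ∃ (x : ℝ → EuclideanSpace ℝ (Fin n)) (u : ℝ → EuclideanSpace ℝ (Fin p)),
        IsC1Trajectory Ω f t₀ t₁ x u ∧
        c1Norm t₀ t₁ (fun t => u t - ubar t) ≤ ε ∧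
        x t₀ = x₀ ∧ x t₁ = x₁

/-- `x` is the (continuous, integral-sense) solution on `[t₀, t₁]` of
`x'(t) = A(t) x(t) + B(t) u(t)`, `x(t₀) = x₀`. -/
def IsLinearSolution {n p : ℕ} (t₀ t₁ : ℝ)
    (A : ℝ → EuclideanSpace ℝ (Fin n) →L[ℝ] EuclideanSpace ℝ (Fin n))
    (B : ℝ → EuclideanSpace ℝ (Fin p) →L[ℝ] EuclideanSpace ℝ (Fin n))
    (u : ℝ → EuclideanSpace ℝ (Fin p)) (x₀ : EuclideanSpace ℝ (Fin n))
    (x : ℝ → EuclideanSpace ℝ (Fin n)) : Prop :=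
  ContinuousOn x (Icc t₀ t₁) ∧
    ∀ t ∈ Icc t₀ t₁, x t = x₀ + (∫ s in t₀..t, A s (x s)) + ∫ s in t₀..t, B s (u s)

/-- Controllability of `x'(t) = A(t) x(t) + B(t) u(t)` for the time interval `[t₀, t₁]`, with
controls in `L²((t₀, t₁), ℝᵖ)`. -/
def LinearControllable {n p : ℕ} (t₀ t₁ : ℝ)
    (A : ℝ → EuclideanSpace ℝ (Fin n) →L[ℝ] EuclideanSpace ℝ (Fin n))
    (B : ℝ → EuclideanSpace ℝ (Fin p) →L[ℝ] EuclideanSpace ℝ (Fin n)) : Prop :=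
  ∀ x₀ x₁ : EuclideanSpace ℝ (Fin n),
    ∃ u : ℝ → EuclideanSpace ℝ (Fin p), MemLp u 2 (volume.restrict (Ioo t₀ t₁)) ∧
      ∃ x : ℝ → EuclideanSpace ℝ (Fin n), IsLinearSolution t₀ t₁ A B u x₀ x ∧ x t₁ = x₁

/-- `A(t) = ∂f/∂x (xbar(t), ubar(t))`. -/
def linearizedState {n p : ℕ}
    (f : EuclideanSpace ℝ (Fin n) × EuclideanSpace ℝ (Fin p) → EuclideanSpace ℝ (Fin n))
    (xbar : ℝ → EuclideanSpace ℝ (Fin n)) (ubar : ℝ → EuclideanSpace ℝ (Fin p)) (t : ℝ) :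
    EuclideanSpace ℝ (Fin n) →L[ℝ] EuclideanSpace ℝ (Fin n) :=
  fderiv ℝ (fun y => f (y, ubar t)) (xbar t)

/-- `B(t) = ∂f/∂u (xbar(t), ubar(t))`. -/
def linearizedControl {n p : ℕ}
    (f : EuclideanSpace ℝ (Fin n) × EuclideanSpace ℝ (Fin p) → EuclideanSpace ℝ (Fin n))
    (xbar : ℝ → EuclideanSpace ℝ (Fin n)) (ubar : ℝ → EuclideanSpace ℝ (Fin p)) (t : ℝ) :
    EuclideanSpace ℝ (Fin p) →L[ℝ] EuclideanSpace ℝ (Fin n) :=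
  fderiv ℝ (fun v => f (xbar t, v)) (ubar t)

end

/-! The two-point problem is solved by an open mapping argument. A `C¹` perturbation of the control
is encoded by its initial value and derivative, `v ∈ F × C([a, b], F)`, so that the unknowns range
over a Banach space. With `V` the perturbation encoded by `v`, put `Φ(x, v) = (x - ∫ f(x, U + V),
x(b))`. At `(X, 0)` its value is the constant `X(a)` paired with `X(b)`, and `Φ(x, v) = (x₀, x₁)` is
exactly the problem to be solved.

`Φ` is strictly differentiable because superposition by a `C¹` map is
(`hasStrictFDerivAt_superposition`). If its derivative is onto, `Φ` maps neighbourhoods of `(X, 0)`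
onto neighbourhoods of the value there, which gives `δ` (`exists_solution_near`).

Surjectivity is the linear control problem with `C¹` controls (`exists_linear_solution`). The
Volterra operator `1 - K` is invertible (`isUnit_one_sub_volterra`), so only the endpoint has to be
steered. Endpoints reached by `C¹` controls form a subspace of a finite-dimensional space, hence a
closed one; density of `C¹` in `L¹` shows that it contains every endpoint reached by an integrable
control (`mem_range_of_integrable_control`). -/

open Topology Filter

noncomputable section

/-! ### Volterra operators on `C([a, b], E)`. -/

section Operators

variable {E G : Type*} [NormedAddCommGroup E] [NormedSpace ℝ E]
  [NormedAddCommGroup G] [NormedSpace ℝ G]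

/-- Pointwise application of a continuous family of continuous linear maps. -/
def pointwiseCLM {X : Type*} [TopologicalSpace X] [CompactSpace X] (L : C(X, G →L[ℝ] E)) :
    C(X, G) →L[ℝ] C(X, E) :=
  LinearMap.mkContinuous
    { toFun := fun y => ⟨fun t => L t (y t), by fun_prop⟩
      map_add' := fun y z => by ext t; simp
      map_smul' := fun c y => by ext t; simp } ‖L‖ fun y => by
    rw [ContinuousMap.norm_le _ (by positivity)]
    intro t
    exact (L t).le_of_opNorm_le_of_le (L.norm_coe_le_norm t) (y.norm_coe_le_norm t)

@[simp]
lemma pointwiseCLM_apply {X : Type*} [TopologicalSpace X] [CompactSpace X]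
    (L : C(X, G →L[ℝ] E)) (y : C(X, G)) (t : X) : pointwiseCLM L y t = L t (y t) := rfl

variable {a b : ℝ}

lemma continuous_comp_projIcc {Y : Type*} [TopologicalSpace Y] (h : a ≤ b) (y : C(Icc a b, Y)) :
    Continuous fun s : ℝ => y (projIcc a b h s) :=
  y.continuous.comp continuous_projIcc

variable [CompleteSpace E]

lemma hasDerivAt_integral_comp_projIcc (h : a ≤ b) (y : C(Icc a b, E)) (t : ℝ) :
    HasDerivAt (fun t => ∫ s in a..t, y (projIcc a b h s)) (y (projIcc a b h t)) t :=
  intervalIntegral.integral_hasDerivAt_right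
    ((continuous_comp_projIcc h y).intervalIntegrable _ _)
    ((continuous_comp_projIcc h y).stronglyMeasurableAtFilter _ _)
    (continuous_comp_projIcc h y).continuousAt

/-- The primitive vanishing at the left end point, as an operator on `C([a, b], E)`. -/
def primitiveCLM (E : Type*) [NormedAddCommGroup E] [NormedSpace ℝ E] [CompleteSpace E]
    (h : a ≤ b) : C(Icc a b, E) →L[ℝ] C(Icc a b, E) :=
  LinearMap.mkContinuous
    { toFun := fun y => ⟨fun t => ∫ s in a..t, y (projIcc a b h s),
        (continuous_iff_continuousAt.2 fun t =>
          (hasDerivAt_integral_comp_projIcc h y t).continuousAt).comp continuous_subtype_val⟩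
      map_add' := fun y z => by
        ext t
        exact intervalIntegral.integral_add
          ((continuous_comp_projIcc h y).intervalIntegrable _ _)
          ((continuous_comp_projIcc h z).intervalIntegrable _ _)
      map_smul' := fun c y => by
        ext t
        exact intervalIntegral.integral_smul c _ } (b - a) fun y => by
    rw [ContinuousMap.norm_le _ (mul_nonneg (sub_nonneg.2 h) (norm_nonneg _))]
    intro t
    refine (intervalIntegral.norm_integral_le_of_norm_le_const
      fun s _ => y.norm_coe_le_norm (projIcc a b h s)).trans ?_
    rw [mul_comm, abs_of_nonneg (sub_nonneg.2 t.2.1)]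
    exact mul_le_mul_of_nonneg_right (sub_le_sub_right t.2.2 _) (norm_nonneg _)

@[simp]
lemma primitiveCLM_apply (h : a ≤ b) (y : C(Icc a b, E)) (t : Icc a b) :
    primitiveCLM E h y t = ∫ s in a..t, y (projIcc a b h s) := rfl

/-- Each application of the operator integrates `(s - a) ^ k`, which produces the factorial. Keeping
the dependence on `t` is what makes the induction close. -/
lemma norm_volterra_pow_apply_le (h : a ≤ b) (L : C(Icc a b, E →L[ℝ] E)) (y : C(Icc a b, E))
    (k : ℕ) (t : Icc a b) :
    ‖((primitiveCLM E h ∘L pointwiseCLM L) ^ k) y t‖ ≤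
      (‖L‖ * (t - a)) ^ k / k.factorial * ‖y‖ := by
  induction k generalizing t with
  | zero => simpa using y.norm_coe_le_norm t
  | succ k ih =>
    rw [pow_succ', mul_apply_eq_comp]
    set z := ((primitiveCLM E h ∘L pointwiseCLM L) ^ k) y
    have h1 : ∀ s ∈ Icc a (t : ℝ), ‖pointwiseCLM L z (projIcc a b h s)‖ ≤
        ‖L‖ ^ (k + 1) / k.factorial * ‖y‖ * (s - a) ^ k := by
      intro s hs
      have hs' : s ∈ Icc a b := ⟨hs.1, hs.2.trans t.2.2⟩
      rw [projIcc_of_mem h hs', pointwiseCLM_apply]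
      refine ((L ⟨s, hs'⟩).le_of_opNorm_le_of_le (L.norm_coe_le_norm _) (ih ⟨s, hs'⟩)).trans_eq ?_
      simp only [mul_pow]
      ring
    have h2 : ‖∫ s in a..t, pointwiseCLM L z (projIcc a b h s)‖ ≤
        ∫ s in a..t, ‖L‖ ^ (k + 1) / k.factorial * ‖y‖ * (s - a) ^ k := by
      refine intervalIntegral.norm_integral_le_of_norm_le t.2.1
        (Filter.Eventually.of_forall fun s hs => h1 s (Ioc_subset_Icc_self hs)) ?_
      exact Continuous.intervalIntegrable (by fun_prop) _ _
    refine h2.trans_eq ?_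
    rw [intervalIntegral.integral_const_mul,
      intervalIntegral.integral_comp_sub_right (fun s => s ^ k), integral_pow, mul_pow,
      Nat.factorial_succ]
    push_cast
    have : (k.factorial : ℝ) ≠ 0 := by positivity
    field_simp
    simp

/-- The factorial decay makes some power of `K` a strict contraction, although `K` itself need not
be one. -/
lemma isUnit_one_sub_volterra (h : a ≤ b) (L : C(Icc a b, E →L[ℝ] E)) :
    IsUnit (1 - primitiveCLM E h ∘L pointwiseCLM L) := by
  set K := primitiveCLM E h ∘L pointwiseCLM L
  obtain ⟨k, hk⟩ := ((FloorSemiring.tendsto_pow_div_factorial_atTop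
    (‖L‖ * (b - a))).eventually_lt_const one_pos).exists
  have hba : 0 ≤ b - a := sub_nonneg.2 h
  have hK : ‖K ^ k‖ < 1 := by
    refine (ContinuousLinearMap.opNorm_le_bound _ (by positivity) fun y => ?_).trans_lt hk
    rw [ContinuousMap.norm_le _ (by positivity)]
    intro t
    refine (norm_volterra_pow_apply_le h L y k t).trans ?_
    have := t.2.1
    have := t.2.2
    have : 0 ≤ (t : ℝ) - a := by linarith
    gcongr
  -- The product telescopes to `1 - K ^ k`, a unit by the Neumann series; since the two factors
  -- commute, each of them is a unit.
  have hu : IsUnit ((1 - K) * ∑ i ∈ Finset.range k, K ^ i) := by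
    rw [mul_neg_geom_sum]
    exact isUnit_one_sub_of_norm_lt_one (x := K ^ k) hK
  refine (Commute.isUnit_mul_iff ?_).1 hu |>.1
  exact Commute.sum_right _ _ _ fun i _ =>
    ((Commute.one_left _).sub_left (Commute.refl K)).pow_right i

end Operators

/-! ### Strict differentiability of superposition operators. -/

section Nemytskii

variable {E G : Type*} [NormedAddCommGroup E] [NormedSpace ℝ E]
  [NormedAddCommGroup G] [NormedSpace ℝ G]
  {X : Type*} [TopologicalSpace X] [CompactSpace X]

open Classical in
/-- The superposition operator `z ↦ f ∘ z`, with value `0` where `f ∘ z` is not continuous. -/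
def superposition (f : G → E) (z : C(X, G)) : C(X, E) :=
  if h : Continuous (f ∘ z) then ⟨f ∘ z, h⟩ else 0

omit [NormedSpace ℝ E] [NormedSpace ℝ G] [CompactSpace X] in
lemma superposition_apply {Ω : Set G} {f : G → E} (hf : ContinuousOn f Ω) {z : C(X, G)}
    (hz : ∀ t, z t ∈ Ω) (t : X) : superposition f z t = f (z t) := by
  have h : Continuous (f ∘ z) := hf.comp_continuous z.continuous hz
  simp [superposition, h]

omit [NormedSpace ℝ G] in
lemma eventually_forall_mem_of_isOpen {Ω : Set G} (hΩ : IsOpen Ω) {z : C(X, G)}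
    (hz : ∀ t, z t ∈ Ω) : ∀ᶠ w : C(X, G) in 𝓝 z, ∀ t, w t ∈ Ω := by
  have := ContinuousMap.eventually_mapsTo (f := z) isCompact_univ hΩ fun t _ => hz t
  filter_upwards [this] with w hw t using hw (mem_univ t)

/-- Pointwise strict differentiability of `f` along the compact curve `z` becomes uniform in `t`,
and a uniform estimate is an estimate in the sup norm. -/
lemma hasStrictFDerivAt_superposition {Ω : Set G} (hΩ : IsOpen Ω) {f : G → E}
    (hf : ContDiffOn ℝ 1 f Ω) {z : C(X, G)} (hz : ∀ t, z t ∈ Ω) (L : C(X, G →L[ℝ] E))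
    (hL : ∀ t, L t = fderiv ℝ f (z t)) :
    HasStrictFDerivAt (superposition f : C(X, G) → C(X, E)) (pointwiseCLM L) z := by
  -- Compactness gives one neighbourhood of increments valid for all `t`. Near a fixed `t`, half of
  -- `c` pays for the remainder of `f` and half for replacing `L t` by `L r.2`.
  have hloc : ∀ c : ℝ, 0 < c → ∀ᶠ q : G × G in 𝓝 0, ∀ t ∈ (univ : Set X),
      ‖f (z t + q.1) - f (z t + q.2) - L t (q.1 - q.2)‖ ≤ c * ‖q.1 - q.2‖ := by
    intro c hc
    refine isCompact_univ.eventually_forall_of_forall_eventually fun t _ => ?_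
    have h1 : HasStrictFDerivAt f (L t) (z t) := by
      rw [hL]
      exact (hf.contDiffAt (hΩ.mem_nhds (hz t))).hasStrictFDerivAt one_ne_zero
    have h2 := h1.isLittleO.def (half_pos hc)
    have h3 : Tendsto (fun r : (G × G) × X => (z r.2 + r.1.1, z r.2 + r.1.2)) (𝓝 (0, t))
        (𝓝 (z t, z t)) := by
      have : Continuous (fun r : (G × G) × X => (z r.2 + r.1.1, z r.2 + r.1.2)) := by fun_prop
      simpa using this.tendsto (0, t)
    have h4 : ∀ᶠ r : (G × G) × X in 𝓝 (0, t), ‖L r.2 - L t‖ < c / 2 := by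
      have : Continuous fun r : (G × G) × X => ‖L r.2 - L t‖ := by fun_prop
      exact (this.tendsto (0, t)).eventually_lt_const (by simpa using half_pos hc)
    filter_upwards [h3.eventually h2, h4] with r hr hr'
    simp only [add_sub_add_left_eq_sub] at hr
    have h5 := (L r.2 - L t).le_of_opNorm_le hr'.le (r.1.1 - r.1.2)
    calc ‖f (z r.2 + r.1.1) - f (z r.2 + r.1.2) - L r.2 (r.1.1 - r.1.2)‖
        = ‖(f (z r.2 + r.1.1) - f (z r.2 + r.1.2) - L t (r.1.1 - r.1.2)) -
            (L r.2 - L t) (r.1.1 - r.1.2)‖ := by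
          congr 1
          simp only [sub_apply]
          abel
      _ ≤ c / 2 * ‖r.1.1 - r.1.2‖ + c / 2 * ‖r.1.1 - r.1.2‖ :=
          (norm_sub_le _ _).trans (add_le_add hr h5)
      _ = c * ‖r.1.1 - r.1.2‖ := by ring
  refine .of_isLittleO (Asymptotics.IsLittleO.of_bound fun c hc => ?_)
  obtain ⟨δ, hδ, hball⟩ := Metric.eventually_nhds_iff.1 (hloc c hc)
  have hΩz := eventually_forall_mem_of_isOpen hΩ hz
  have hnear : ∀ᶠ w : C(X, G) in 𝓝 z, dist w z < δ := Metric.ball_mem_nhds z hδ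
  rw [nhds_prod_eq]
  filter_upwards [(hΩz.and hnear).prod_mk (hΩz.and hnear)] with w hw
  rw [ContinuousMap.norm_le _ (by positivity)]
  intro t
  obtain ⟨⟨h1, h2⟩, h3, h4⟩ := hw
  have hq := @hball (w.1 t - z t, w.2 t - z t) (by
    rw [dist_zero_right, Prod.norm_def]
    refine max_lt ?_ ?_
    · simpa [dist_eq_norm] using (ContinuousMap.dist_apply_le_dist t).trans_lt h2
    · simpa [dist_eq_norm] using (ContinuousMap.dist_apply_le_dist t).trans_lt h4) t (mem_univ t)
  simp only [add_sub_cancel, sub_sub_sub_cancel_right] at hq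
  simp only [ContinuousMap.sub_apply, superposition_apply hf.continuousOn h1,
    superposition_apply hf.continuousOn h3, pointwiseCLM_apply]
  refine hq.trans (mul_le_mul_of_nonneg_left ?_ hc.le)
  exact (w.1 - w.2).norm_coe_le_norm t

end Nemytskii

/-! ### Approximation of integrable controls by `C¹` functions. -/

section Density

lemma exists_contDiff_integral_norm_sub_le {F : Type*} [NormedAddCommGroup F] [NormedSpace ℝ F]
    {a b : ℝ} {u : ℝ → F} (hu : IntegrableOn u (Ioc a b)) {ε : ℝ} (hε : 0 < ε) :
    ∃ g : ℝ → F, ContDiff ℝ 1 g ∧ ∫ s in Ioc a b, ‖u s - g s‖ ≤ ε := by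
  obtain ⟨g, hgs, hg, hle⟩ := MemLp.exist_eLpNorm_sub_le (p := 1) ENNReal.one_ne_top le_rfl
    (memLp_one_iff_integrable.2 hu) hε
  refine ⟨g, hg.of_le (by exact_mod_cast le_top), ?_⟩
  have hgi : Integrable g (volume.restrict (Ioc a b)) :=
    hg.continuous.integrable_of_hasCompactSupport hgs
  rw [eLpNorm_one_eq_lintegral_enorm, ← ofReal_integral_norm_eq_lintegral_enorm (hu.sub hgi),
    ENNReal.ofReal_le_ofReal_iff hε.le] at hle
  simpa using hle

end Density

/-! ### Linear controllability with `C¹` controls. -/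

section Reachability

variable {E F : Type*} [NormedAddCommGroup E] [NormedSpace ℝ E] [CompleteSpace E]
  [NormedAddCommGroup F] [NormedSpace ℝ F] [CompleteSpace F] {a b : ℝ}

/-- The continuous linear map sending a vector to the corresponding constant function. -/
def constantCLM (X E : Type*) [TopologicalSpace X] [CompactSpace X] [NormedAddCommGroup E]
    [NormedSpace ℝ E] : E →L[ℝ] C(X, E) :=
  LinearMap.mkContinuous
    { toFun := fun c => ContinuousMap.const X c
      map_add' := fun _ _ => rfl
      map_smul' := fun _ _ => rfl } 1 fun c => by
    rw [one_mul, ContinuousMap.norm_le _ (norm_nonneg _)]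
    exact fun _ => le_rfl

omit [CompleteSpace E] in
@[simp]
lemma constantCLM_apply {X : Type*} [TopologicalSpace X] [CompactSpace X] (c : E) (t : X) :
    constantCLM X E c t = c := rfl

/-- The `C¹` function with prescribed initial value and derivative. -/
def antiderivativeCLM (F : Type*) [NormedAddCommGroup F] [NormedSpace ℝ F] [CompleteSpace F]
    (h : a ≤ b) : F × C(Icc a b, F) →L[ℝ] C(Icc a b, F) :=
  constantCLM (Icc a b) F ∘L ContinuousLinearMap.fst ℝ F _ +
    primitiveCLM F h ∘L ContinuousLinearMap.snd ℝ F _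

@[simp]
lemma antiderivativeCLM_apply (h : a ≤ b) (v : F × C(Icc a b, F)) (t : Icc a b) :
    antiderivativeCLM F h v t = v.1 + ∫ s in a..t, v.2 (projIcc a b h s) := rfl

lemma exists_antiderivativeCLM_eq (h : a ≤ b) {g : ℝ → F} (hg : ContDiff ℝ 1 g) :
    ∃ v, ∀ t : Icc a b, antiderivativeCLM F h v t = g t := by
  have hg' : Continuous (deriv g) := hg.continuous_deriv le_rfl
  refine ⟨(g a, ⟨fun t => deriv g t, hg'.comp continuous_subtype_val⟩), fun t => ?_⟩
  rw [antiderivativeCLM_apply]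
  have : ∫ s in a..t, deriv g s = g t - g a :=
    intervalIntegral.integral_deriv_eq_sub
      (fun s _ => (hg.differentiable one_ne_zero).differentiableAt) (hg'.intervalIntegrable _ _)
  refine (sub_eq_iff_eq_add'.1 ?_).symm
  rw [← this]
  refine intervalIntegral.integral_congr fun s hs => ?_
  rw [uIcc_of_le t.2.1] at hs
  simp [projIcc_of_mem h ⟨hs.1, hs.2.trans t.2.2⟩]

omit [CompleteSpace E] [CompleteSpace F] in
lemma integrableOn_clm_apply (h : a ≤ b) (B : C(Icc a b, F →L[ℝ] E)) {u : ℝ → F} {s : Set ℝ}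
    (hu : IntegrableOn u s) : IntegrableOn (fun s => B (projIcc a b h s) (u s)) s := by
  refine Integrable.mono' (hu.norm.const_mul ‖B‖) ?_
    (Eventually.of_forall fun s => (B _).le_of_opNorm_le (B.norm_coe_le_norm _) _)
  have : AEStronglyMeasurable (fun s => B (projIcc a b h s)) (volume.restrict s) :=
    (continuous_comp_projIcc h B).aestronglyMeasurable
  exact (ContinuousLinearMap.id ℝ (F →L[ℝ] E)).aestronglyMeasurable_comp₂ this hu.aestronglyMeasurable

/-- If `C([a, b], E) → E` is continuous linear, its values on the forcings `∫ B u` with `u`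
integrable already occur with `u` of class `C¹`. -/
lemma mem_range_of_integrable_control [FiniteDimensional ℝ E] (h : a ≤ b)
    (B : C(Icc a b, F →L[ℝ] E)) (T : C(Icc a b, E) →L[ℝ] E) {u : ℝ → F}
    (hu : IntegrableOn u (Ioc a b)) {q : C(Icc a b, E)}
    (hq : ∀ t : Icc a b, q t = ∫ s in a..t, B (projIcc a b h s) (u s)) :
    T q ∈ (T ∘L primitiveCLM E h ∘L pointwiseCLM B ∘L antiderivativeCLM F h).range := by
  set R := T ∘L primitiveCLM E h ∘L pointwiseCLM B ∘L antiderivativeCLM F h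
  have hclosed : IsClosed (R.range : Set E) := Submodule.closed_of_finiteDimensional _
  change T q ∈ (R.range : Set E)
  rw [← hclosed.closure_eq, Metric.mem_closure_iff]
  intro ε hε
  -- The added `1` keeps `M` positive, and the half in `ε / M / 2` makes the final inequality
  -- strict.
  set M := ‖T‖ * ‖B‖ + 1
  have hM : 0 < M := by positivity
  obtain ⟨g, hg, hle⟩ := exists_contDiff_integral_norm_sub_le hu (half_pos (div_pos hε hM))
  obtain ⟨v, hv⟩ := exists_antiderivativeCLM_eq h hg
  refine ⟨R v, ⟨v, rfl⟩, ?_⟩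
  have hgi : IntegrableOn g (Ioc a b) := hg.continuous.integrableOn_Ioc
  set w := primitiveCLM E h (pointwiseCLM B (antiderivativeCLM F h v))
  have key : ‖q - w‖ ≤ ‖B‖ * (ε / M / 2) := by
    rw [ContinuousMap.norm_le _ (by positivity)]
    intro t
    have hw : w t = ∫ s in a..t, B (projIcc a b h s) (g s) := by
      refine intervalIntegral.integral_congr fun s hs => ?_
      rw [uIcc_of_le t.2.1] at hs
      have hs' : s ∈ Icc a b := ⟨hs.1, hs.2.trans t.2.2⟩
      simp only [pointwiseCLM_apply, hv, projIcc_of_mem h hs']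
    have hsub : Ioc a (t : ℝ) ⊆ Ioc a b := Ioc_subset_Ioc_right t.2.2
    have hBu := integrableOn_clm_apply h B hu
    have hBg := integrableOn_clm_apply h B hgi
    rw [ContinuousMap.sub_apply, hq, hw, intervalIntegral.integral_of_le t.2.1,
      intervalIntegral.integral_of_le t.2.1,
      ← integral_sub (hBu.mono_set hsub) (hBg.mono_set hsub)]
    calc _ ≤ ∫ s in Ioc a (t : ℝ), ‖B‖ * ‖u s - g s‖ := by
          refine norm_integral_le_of_norm_le
            (((hu.sub hgi).mono_set hsub).norm.const_mul _) (Eventually.of_forall fun s => ?_)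
          rw [← map_sub]
          exact (B _).le_of_opNorm_le (B.norm_coe_le_norm _) _
      _ ≤ ∫ s in Ioc a b, ‖B‖ * ‖u s - g s‖ :=
          setIntegral_mono_set ((hu.sub hgi).norm.const_mul _)
            (Eventually.of_forall fun s => by positivity) hsub.eventuallyLE
      _ ≤ _ := by
          rw [integral_const_mul]
          gcongr
  calc dist (T q) (R v) = ‖T (q - w)‖ := by rw [map_sub, dist_eq_norm]; rfl
    _ ≤ ‖T‖ * (‖B‖ * (ε / M / 2)) := T.le_of_opNorm_le_of_le le_rfl key
    _ = ‖T‖ * ‖B‖ * (ε / M / 2) := by ring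
    _ ≤ M * (ε / M / 2) := by
        gcongr
        exact le_add_of_nonneg_right zero_le_one
    _ < ε := by
        have : M * (ε / M / 2) = ε / 2 := by field_simp
        linarith

/-- By superposition: `S = (1 - K)⁻¹` absorbs the source `g`, and the control corrects the endpoint
that `g` alone would produce. -/
lemma exists_linear_solution [FiniteDimensional ℝ E] (h : a ≤ b)
    (A : C(Icc a b, E →L[ℝ] E)) (B : C(Icc a b, F →L[ℝ] E))
    (hc : ∀ e : E, ∃ u : ℝ → F, IntegrableOn u (Ioc a b) ∧ ∃ x : C(Icc a b, E),
      (∀ t : Icc a b, x t = (∫ s in a..t, A (projIcc a b h s) (x (projIcc a b h s))) +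
        ∫ s in a..t, B (projIcc a b h s) (u s)) ∧ x ⟨b, right_mem_Icc.2 h⟩ = e)
    (g : C(Icc a b, E)) (e : E) :
    ∃ (y : C(Icc a b, E)) (v : F × C(Icc a b, F)),
      y - primitiveCLM E h (pointwiseCLM A y + pointwiseCLM B (antiderivativeCLM F h v)) = g ∧
        y ⟨b, right_mem_Icc.2 h⟩ = e := by
  obtain ⟨U, hU⟩ := isUnit_one_sub_volterra h A
  set K := primitiveCLM E h ∘L pointwiseCLM A
  set S : C(Icc a b, E) →L[ℝ] C(Icc a b, E) := ↑U⁻¹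
  have hS1 : ∀ y, S (y - K y) = y := fun y => by
    have := congrArg (fun W => W y) U.inv_mul
    rwa [hU] at this
  have hS2 : ∀ y, S y - K (S y) = y := fun y => by
    have := congrArg (fun W => W y) U.mul_inv
    rwa [hU] at this
  let ev : C(Icc a b, E) →L[ℝ] E := ContinuousMap.evalCLM ℝ ⟨b, right_mem_Icc.2 h⟩
  have hR : ∀ e : E, ∃ v,
      ev (S (primitiveCLM E h (pointwiseCLM B (antiderivativeCLM F h v)))) = e := by
    intro e
    obtain ⟨u, hu, x, hx, rfl⟩ := hc e
    have hq : ∀ t : Icc a b, (x - K x) t = ∫ s in a..t, B (projIcc a b h s) (u s) := fun t =>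
      sub_eq_iff_eq_add'.2 (hx t)
    obtain ⟨v, hv⟩ := mem_range_of_integrable_control h B (ev ∘L S) hu hq
    exact ⟨v, hv.trans (congrArg ev (hS1 x))⟩
  -- The source `g` alone ends at `ev (S g)`, so the control must supply the difference.
  obtain ⟨v, hv⟩ := hR (e - ev (S g))
  refine ⟨S (g + primitiveCLM E h (pointwiseCLM B (antiderivativeCLM F h v))), v, ?_, ?_⟩
  · have := hS2 (g + primitiveCLM E h (pointwiseCLM B (antiderivativeCLM F h v)))
    rw [map_add (primitiveCLM E h), ← sub_sub]
    exact sub_eq_iff_eq_add.2 this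
  · change ev _ = e
    rw [map_add, map_add, hv, add_sub_cancel]

end Reachability

/-! ### The nonlinear two-point problem near the reference trajectory. -/

section LocalSolvability

variable {E F : Type*} [NormedAddCommGroup E] [NormedSpace ℝ E] [CompleteSpace E]
  [NormedAddCommGroup F] [NormedSpace ℝ F] [CompleteSpace F] {a b : ℝ}

/-- The pair formed by a state and the control with given initial value and derivative. -/
def stateControlCLM (E F : Type*) [NormedAddCommGroup E] [NormedSpace ℝ E]
    [NormedAddCommGroup F] [NormedSpace ℝ F] [CompleteSpace F] (h : a ≤ b) :
    C(Icc a b, E) × (F × C(Icc a b, F)) →L[ℝ] C(Icc a b, E × F) :=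
  (ContinuousLinearMap.inl ℝ E F).compLeftContinuous ℝ (Icc a b) ∘L ContinuousLinearMap.fst ℝ _ _ +
    (ContinuousLinearMap.inr ℝ E F).compLeftContinuous ℝ (Icc a b) ∘L antiderivativeCLM F h ∘L
      ContinuousLinearMap.snd ℝ _ _

omit [CompleteSpace E] in
lemma stateControlCLM_apply (h : a ≤ b) (w : C(Icc a b, E) × (F × C(Icc a b, F)))
    (t : Icc a b) : stateControlCLM E F h w t = (w.1 t, antiderivativeCLM F h w.2 t) := by
  change (w.1 t, (0 : F)) + ((0 : E), antiderivativeCLM F h w.2 t) = _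
  simp

/-- Local solvability of the two-point control problem for the integral equation
`x = x₀ + ∫ f(x, U + v)`, when the linearized system is controllable. -/
lemma exists_solution_near [FiniteDimensional ℝ E] (h : a ≤ b) {Ω : Set (E × F)} (hΩ : IsOpen Ω)
    {f : E × F → E} (hf : ContDiffOn ℝ 1 f Ω) (X : C(Icc a b, E)) (U : C(Icc a b, F))
    (hz : ∀ t, (X t, U t) ∈ Ω)
    (hX : ∀ t : Icc a b, X t = X ⟨a, left_mem_Icc.2 h⟩ +
      ∫ s in a..t, f (X (projIcc a b h s), U (projIcc a b h s)))
    (A : C(Icc a b, E →L[ℝ] E)) (B : C(Icc a b, F →L[ℝ] E))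
    (hAB : ∀ t, (A t).coprod (B t) = fderiv ℝ f (X t, U t))
    (hc : ∀ e : E, ∃ u : ℝ → F, IntegrableOn u (Ioc a b) ∧ ∃ x : C(Icc a b, E),
      (∀ t : Icc a b, x t = (∫ s in a..t, A (projIcc a b h s) (x (projIcc a b h s))) +
        ∫ s in a..t, B (projIcc a b h s) (u s)) ∧ x ⟨b, right_mem_Icc.2 h⟩ = e)
    {η : ℝ} (hη : 0 < η) :
    ∃ δ : ℝ, 0 < δ ∧ ∀ x₀ ∈ Metric.ball (X ⟨a, left_mem_Icc.2 h⟩) δ,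
      ∀ x₁ ∈ Metric.ball (X ⟨b, right_mem_Icc.2 h⟩) δ,
      ∃ (x : C(Icc a b, E)) (v : F × C(Icc a b, F)), ‖v‖ < η ∧
        (∀ t, (x t, U t + antiderivativeCLM F h v t) ∈ Ω) ∧
        (∀ t : Icc a b, x t = x₀ + ∫ s in a..t, f (x (projIcc a b h s),
          U (projIcc a b h s) + antiderivativeCLM F h v (projIcc a b h s))) ∧
        x ⟨b, right_mem_Icc.2 h⟩ = x₁ := by
  set α : Icc a b := ⟨a, left_mem_Icc.2 h⟩
  set β : Icc a b := ⟨b, right_mem_Icc.2 h⟩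
  let L : C(Icc a b, E × F →L[ℝ] E) := ⟨fun t => (A t).coprod (B t), by
    have : (fun t => (A t).coprod (B t)) = fun t =>
        (A t).comp (ContinuousLinearMap.fst ℝ E F) + (B t).comp (ContinuousLinearMap.snd ℝ E F) := by
      ext t <;> simp
    rw [this]
    fun_prop⟩
  -- Shifting by the reference control makes `v` a perturbation, with base point `(X, 0)`.
  let c : C(Icc a b, E × F) := ⟨fun t => (0, U t), by fun_prop⟩
  let Z : C(Icc a b, E) × (F × C(Icc a b, F)) → C(Icc a b, E × F) :=
    fun w => stateControlCLM E F h w + c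
  have hZ : ∀ w t, Z w t = (w.1 t, U t + antiderivativeCLM F h w.2 t) := fun w t => by
    simp [Z, c, stateControlCLM_apply, add_comm]
  let w₀ : C(Icc a b, E) × (F × C(Icc a b, F)) := (X, 0)
  have hZ₀ : ∀ t, Z w₀ t = (X t, U t) := fun t => by simp [hZ, w₀]
  have hZΩ : ∀ t, Z w₀ t ∈ Ω := fun t => by rw [hZ₀]; exact hz t
  have hZd : HasStrictFDerivAt Z (stateControlCLM E F h) w₀ :=
    (stateControlCLM E F h).hasStrictFDerivAt.add_const c
  have hN : HasStrictFDerivAt (superposition f : C(Icc a b, E × F) → C(Icc a b, E))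
      (pointwiseCLM L) (Z w₀) :=
    hasStrictFDerivAt_superposition hΩ hf hZΩ L fun t => by rw [hZ₀]; exact hAB t
  let ev : C(Icc a b, E) →L[ℝ] E := ContinuousMap.evalCLM ℝ β
  let Φ : C(Icc a b, E) × (F × C(Icc a b, F)) → C(Icc a b, E) × E :=
    fun w => (w.1 - primitiveCLM E h (superposition f (Z w)), ev w.1)
  let Φ' : C(Icc a b, E) × (F × C(Icc a b, F)) →L[ℝ] C(Icc a b, E) × E :=
    (ContinuousLinearMap.fst ℝ _ _ -
      primitiveCLM E h ∘L pointwiseCLM L ∘L stateControlCLM E F h).prod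
      (ev ∘L ContinuousLinearMap.fst ℝ _ _)
  have hΦ : HasStrictFDerivAt Φ Φ' w₀ :=
    (hasStrictFDerivAt_fst.sub
      ((primitiveCLM E h).hasStrictFDerivAt.comp w₀ (hN.comp w₀ hZd))).prodMk
      (ev.hasStrictFDerivAt.comp w₀ hasStrictFDerivAt_fst)
  have hsurj : Φ'.range = ⊤ := by
    refine LinearMap.range_eq_top.2 fun ⟨g, e⟩ => ?_
    obtain ⟨y, v, hy, hye⟩ := exists_linear_solution h A B hc g e
    refine ⟨(y, v), Prod.ext ?_ hye⟩
    rw [← hy]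
    change y - primitiveCLM E h (pointwiseCLM L (stateControlCLM E F h (y, v))) = _
    congr 2
    ext t
    simp [stateControlCLM_apply, L]
  have hΦ₀ : Φ w₀ = (constantCLM (Icc a b) E (X α), X β) := by
    refine Prod.ext (ContinuousMap.ext fun t => ?_) rfl
    change X t - ∫ s in a..t, superposition f (Z w₀) (projIcc a b h s) = X α
    simp only [superposition_apply hf.continuousOn hZΩ, hZ₀]
    exact sub_eq_iff_eq_add.2 (hX t)
  have hmem : {w | ‖w.2‖ < η ∧ ∀ t, Z w t ∈ Ω} ∈ 𝓝 w₀ := by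
    have h1 : ∀ᶠ w in 𝓝 w₀, ‖w.2‖ < η :=
      (continuous_snd.norm.tendsto w₀).eventually_lt_const (by simpa [w₀] using hη)
    exact h1.and (hZd.continuousAt.eventually (eventually_forall_mem_of_isOpen hΩ hZΩ))
  -- Openness at `w₀`: a surjective strict derivative between Banach spaces sends neighbourhoods to
  -- neighbourhoods, with no complement of the kernel needed.
  have himage := image_mem_map (m := Φ) hmem
  rw [hΦ.map_nhds_eq_of_surj hsurj, hΦ₀] at himage
  have hcont : Continuous fun q : E × E => (constantCLM (Icc a b) E q.1, q.2) := by fun_prop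
  obtain ⟨δ, hδ, hball⟩ := Metric.mem_nhds_iff.1 ((hcont.tendsto (X α, X β)) himage)
  refine ⟨δ, hδ, fun x₀ hx₀ x₁ hx₁ => ?_⟩
  obtain ⟨⟨x, v⟩, ⟨hv, hxΩ⟩, hw⟩ := hball (show (x₀, x₁) ∈ Metric.ball (X α, X β) δ by
    rw [← ball_prod_same]
    exact ⟨hx₀, hx₁⟩)
  refine ⟨x, v, hv, fun t => hZ (x, v) t ▸ hxΩ t, fun t => ?_, congrArg Prod.snd hw⟩
  have := congrArg (fun q => q.1 t) hw
  change x t - ∫ s in a..t, superposition f (Z (x, v)) (projIcc a b h s) = x₀ at this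
  simp only [superposition_apply hf.continuousOn hxΩ, hZ] at this
  exact sub_eq_iff_eq_add.1 this

end LocalSolvability

/-! ### Transfer to functions on the real line and conclusion. -/

lemma c1Norm_le_of_hasDerivAt {p : ℕ} {a b : ℝ} (hab : a < b)
    {g g' : ℝ → EuclideanSpace ℝ (Fin p)} (hg : ∀ t, HasDerivAt g (g' t) t) {r r' : ℝ}
    (hr : ∀ t ∈ Icc a b, ‖g t‖ ≤ r) (hr' : ∀ t ∈ Icc a b, ‖g' t‖ ≤ r') :
    c1Norm a b g ≤ r + r' := by
  have : Nonempty (Icc a b) := ⟨⟨a, left_mem_Icc.2 hab.le⟩⟩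
  refine add_le_add (ciSup_le fun t => hr t t.2) (ciSup_le fun t => ?_)
  rw [(hg t).hasDerivWithinAt.derivWithin (uniqueDiffOn_Icc hab t t.2)]
  exact hr' t t.2

lemma contDiff_one_of_hasDerivAt {E : Type*} [NormedAddCommGroup E] [NormedSpace ℝ E]
    {g g' : ℝ → E} (hg : ∀ t, HasDerivAt g (g' t) t) (hg' : Continuous g') : ContDiff ℝ 1 g := by
  rw [contDiff_one_iff_deriv]
  exact ⟨fun t => (hg t).differentiableAt, by rwa [funext fun t => (hg t).deriv]⟩

end

theorem theorem8p1 {n p : ℕ}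
    (Ω : Set (EuclideanSpace ℝ (Fin n) × EuclideanSpace ℝ (Fin p))) (hΩ : IsOpen Ω)
    (f : EuclideanSpace ℝ (Fin n) × EuclideanSpace ℝ (Fin p) → EuclideanSpace ℝ (Fin n))
    (hf : ContDiffOn ℝ 1 f Ω)
    (t₀ t₁ : ℝ) (ht : t₀ < t₁)
    (xbar : ℝ → EuclideanSpace ℝ (Fin n)) (ubar : ℝ → EuclideanSpace ℝ (Fin p))
    (htraj : IsC1Trajectory Ω f t₀ t₁ xbar ubar)
    (hlin : LinearControllable t₀ t₁ (linearizedState f xbar ubar)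
      (linearizedControl f xbar ubar)) :
    LocallyControllableAlong Ω f t₀ t₁ xbar ubar := by
  have h := ht.le
  let X : C(Icc t₀ t₁, EuclideanSpace ℝ (Fin n)) :=
    ⟨fun t => xbar t, htraj.contDiffOn_state.continuousOn.domRestrict⟩
  let U : C(Icc t₀ t₁, EuclideanSpace ℝ (Fin p)) :=
    ⟨fun t => ubar t, htraj.contDiffOn_control.continuousOn.domRestrict⟩
  have hz : ∀ t, (X t, U t) ∈ Ω := fun t => htraj.mem_domain t t.2
  have hcongr : ∀ t ∈ Icc t₀ t₁, ∀ s ∈ uIcc t₀ t, s ∈ Icc t₀ t₁ := fun t htI s hs => by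
    rw [uIcc_of_le htI.1] at hs
    exact ⟨hs.1, hs.2.trans htI.2⟩
  have hfz : Continuous fun t => f (X t, U t) :=
    hf.continuousOn.comp_continuous (by fun_prop) hz
  have hX : ∀ t : Icc t₀ t₁, X t = X ⟨t₀, left_mem_Icc.2 h⟩ +
      ∫ s in t₀..t, f (X (projIcc t₀ t₁ h s), U (projIcc t₀ t₁ h s)) := fun t => by
    have hsub : Icc t₀ (t : ℝ) ⊆ Icc t₀ t₁ := Icc_subset_Icc_right t.2.2
    refine (sub_eq_iff_eq_add'.1 ?_)
    refine (intervalIntegral.integral_eq_sub_of_hasDerivAt_of_le t.2.1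
      (htraj.contDiffOn_state.continuousOn.mono hsub) (fun s hs => ?_) ?_).symm
    · have hs' : s ∈ Icc t₀ t₁ := hsub (Ioo_subset_Icc_self hs)
      rw [projIcc_of_mem h hs']
      exact (htraj.hasDerivWithinAt s hs').hasDerivAt
        (Icc_mem_nhds hs.1 (hs.2.trans_le t.2.2))
    · exact (hfz.comp continuous_projIcc).intervalIntegrable _ _
  have hdf : Continuous fun t => fderiv ℝ f (X t, U t) :=
    (hf.continuousOn_fderiv_of_isOpen hΩ le_rfl).comp_continuous (by fun_prop) hz
  let A : C(Icc t₀ t₁, EuclideanSpace ℝ (Fin n) →L[ℝ] EuclideanSpace ℝ (Fin n)) :=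
    ⟨fun t => (fderiv ℝ f (X t, U t)).comp (ContinuousLinearMap.inl ℝ _ _), by fun_prop⟩
  let B : C(Icc t₀ t₁, EuclideanSpace ℝ (Fin p) →L[ℝ] EuclideanSpace ℝ (Fin n)) :=
    ⟨fun t => (fderiv ℝ f (X t, U t)).comp (ContinuousLinearMap.inr ℝ _ _), by fun_prop⟩
  have hfd : ∀ t, HasFDerivAt f (fderiv ℝ f (X t, U t)) (X t, U t) := fun t =>
    ((hf.contDiffAt (hΩ.mem_nhds (hz t))).differentiableAt one_ne_zero).hasFDerivAt
  have hA : ∀ t : Icc t₀ t₁, linearizedState f xbar ubar t = A t := fun t =>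
    ((hfd t).comp (X t) (hasFDerivAt_prodMk_left (X t) (U t))).fderiv
  have hB : ∀ t : Icc t₀ t₁, linearizedControl f xbar ubar t = B t := fun t =>
    ((hfd t).comp (U t) (hasFDerivAt_prodMk_right (X t) (U t))).fderiv
  have hc : ∀ e, ∃ u : ℝ → EuclideanSpace ℝ (Fin p), IntegrableOn u (Ioc t₀ t₁) ∧
      ∃ x : C(Icc t₀ t₁, EuclideanSpace ℝ (Fin n)),
        (∀ t : Icc t₀ t₁, x t =
          (∫ s in t₀..t, A (projIcc t₀ t₁ h s) (x (projIcc t₀ t₁ h s))) +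
          ∫ s in t₀..t, B (projIcc t₀ t₁ h s) (u s)) ∧ x ⟨t₁, right_mem_Icc.2 h⟩ = e := by
    intro e
    -- Steering from the zero state is enough, since other data are handled by superposition.
    obtain ⟨u, hu, x, ⟨hxc, hx⟩, hxe⟩ := hlin 0 e
    refine ⟨u, ?_, ⟨fun t => x t, hxc.domRestrict⟩, fun t => ?_, hxe⟩
    · rw [integrableOn_Ioc_iff_integrableOn_Ioo]
      exact hu.integrable one_le_two
    · refine (hx t t.2).trans ?_
      rw [zero_add]
      congr 1 <;> refine intervalIntegral.integral_congr fun s hs => ?_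
      · have hs' := hcongr t t.2 s hs
        simp only [projIcc_of_mem h hs', ← hA]
        rfl
      · have hs' := hcongr t t.2 s hs
        simp only [projIcc_of_mem h hs', ← hB]
  intro ε hε
  set M := ‖antiderivativeCLM (EuclideanSpace ℝ (Fin p)) h‖
  have hM : 0 < M + 1 := by positivity
  -- The perturbation has sup norm at most `M * ‖v‖` and its derivative at most `‖v‖`, so `‖v‖ < ε /
  -- (M + 1)` gives the `C¹` bound.
  obtain ⟨δ, hδ, H⟩ := exists_solution_near h hΩ hf X U hz hX A B
    (fun t => by ext <;> simp [A, B]) hc (div_pos hε hM)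
  refine ⟨δ, hδ, fun x₀ hx₀ x₁ hx₁ => ?_⟩
  obtain ⟨x, v, hv, hxΩ, hx, hx1⟩ := H x₀ hx₀ x₁ hx₁
  let y : C(Icc t₀ t₁, EuclideanSpace ℝ (Fin n)) :=
    ⟨fun t => f (x t, U t + antiderivativeCLM _ h v t),
      hf.continuousOn.comp_continuous (by fun_prop) hxΩ⟩
  -- Integrands are frozen outside the interval by `projIcc`, so the integral formulas define `C¹`
  -- functions on the whole line.
  have hxd : ∀ t, HasDerivAt (fun t => x₀ + ∫ s in t₀..t, y (projIcc t₀ t₁ h s))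
      (y (projIcc t₀ t₁ h t)) t := fun t =>
    (hasDerivAt_integral_comp_projIcc h y t).const_add x₀
  have hvd : ∀ t, HasDerivAt (fun t => v.1 + ∫ s in t₀..t, v.2 (projIcc t₀ t₁ h s))
      (v.2 (projIcc t₀ t₁ h t)) t := fun t =>
    (hasDerivAt_integral_comp_projIcc h v.2 t).const_add v.1
  have hxt : ∀ t (hI : t ∈ Icc t₀ t₁),
      x₀ + ∫ s in t₀..t, y (projIcc t₀ t₁ h s) = x ⟨t, hI⟩ := fun t hI => (hx ⟨t, hI⟩).symm
  refine ⟨fun t => x₀ + ∫ s in t₀..t, y (projIcc t₀ t₁ h s),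
    fun t => ubar t + (v.1 + ∫ s in t₀..t, v.2 (projIcc t₀ t₁ h s)),
    ⟨?_, ?_, fun t hI => ?_, fun t hI => ?_⟩, ?_, ?_, ?_⟩
  · exact (contDiff_one_of_hasDerivAt hxd (continuous_comp_projIcc h y)).contDiffOn
  · exact htraj.contDiffOn_control.add
      (contDiff_one_of_hasDerivAt hvd (continuous_comp_projIcc h v.2)).contDiffOn
  · rw [hxt t hI]
    exact hxΩ ⟨t, hI⟩
  · have hd := (hxd t).hasDerivWithinAt (s := Icc t₀ t₁)
    rw [projIcc_of_mem h hI] at hd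
    rw [hxt t hI]
    exact hd
  · simp only [add_sub_cancel_left]
    refine (c1Norm_le_of_hasDerivAt ht hvd (r := M * ‖v‖) (r' := ‖v‖) (fun t hI => ?_)
      fun t _ => ?_).trans ?_
    · exact ((antiderivativeCLM _ h v).norm_coe_le_norm ⟨t, hI⟩).trans
        ((antiderivativeCLM _ h).le_opNorm v)
    · exact (v.2.norm_coe_le_norm _).trans (norm_snd_le v)
    · rw [lt_div_iff₀ hM] at hv
      linarith
  · simp
  · exact (hxt t₁ (right_mem_Icc.2 h)).trans hx1
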